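/- Let $\mathbb{K}$ be $\mathbb{R}$ or $\mathbb{C}$ and let $m,n\in\mathbb{N}$. Write $\mathcal{S}_n=\mathcal{S}(\mathbb{R}^n,\mathbb{K})$ for the Schwartz space with its usual Fréchet topology and $\mathcal{S}_n'$ for its topological dual, the space of tempered distributions. Let $\sigma(\mathcal{S}_n)$ be the weak topology on $\mathcal{S}_n$, $\sigma(\mathcal{S}_n')$ the weak* topology on $\mathcal{S}_n'$, and $\beta(\mathcal{S}_n')$ the strong topology on $\mathcal{S}_n'$ (uniform convergence on bounded subsets of $\mathcal{S}_n$). An $\mathcal{S}$-family $v=(v_p)_{p\in\mathbb{R}^m}$ in $\mathcal{S}_n'$ is a family of tempered distributions such that for every $\phi\in\mathcal{S}_n$ the function $\widehat v(\phi):p\mapsto v_p(\phi)$ belongs to $\mathcal{S}_m$. The operator $\widehat v:\mathcal{S}_n\to\mathcal{S}_m$ is then linear and continuous. For $a\in\mathcal{S}_m'$ the superposition $\int_{\mathbb{R}^m}av\in\mathcal{S}_n'$ is defined by $\left(\int_{\mathbb{R}^m}av\right)(\phi)=a(\widehat v(\phi))$; the superposition operator $\int_{\mathbb{R}^m}(\cdot,v):\mathcal{S}_m'\to\mathcal{S}_n'$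 is $a\mapsto\int_{\mathbb{R}^m}av$. The $\mathcal{S}$-linear hull ${}^{\mathcal{S}}\mathrm{span}(v)$ is the set of all superpositions $\int_{\mathbb{R}^m}av$ with $a\in\mathcal{S}_m'$. The family $v$ is $\mathcal{S}$-linearly independent if $\int_{\mathbb{R}^m}av=0$ implies $a=0$, for every $a\in\mathcal{S}_m'$. A topological homomorphism is a continuous linear map that is open onto its image, where the image carries the topology induced by the codomain. **Theorem.** Let $v$ be an $\mathcal{S}$-family in $\mathcal{S}_n'$ indexed by $\mathbb{R}^m$ that is topologically exhaustive, i.e. ${}^{\mathcal{S}}\mathrm{span}(v)$ is $\sigma(\mathcal{S}_n')$-closed. Then the following assertions are equivalent: 1. $v$ is $\mathcal{S}$-linearly independent; 2. the superposition operator $\int_{\mathbb{R}^m}(\cdot,v)$ is an injective topological homomorphism for the weak* topologies $\sigma(\mathcal{S}_m')$ and $\sigma(\mathcal{S}_n')$; 3. the superposition operator $\int_{\mathbb{R}^m}(\cdot,v)$ is an injective topological homomorphism for the strong topologies $\beta(\mathcal{S}_m')$ and $\beta(\mathcal{S}_n')$; 4. the operator $\widehat v$ is a surjective topological homomorphism for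 the weak topologies $\sigma(\mathcal{S}_n)$ and $\sigma(\mathcal{S}_m)$; 5. the operator $\widehat v$ is a surjective topological homomorphism of the topological vector space $\mathcal{S}_n$ onto $\mathcal{S}_m$. -/

import Mathlib

open scoped SchwartzMap ContDiff Topology

noncomputable section

/-! ### Completeness of the Schwartz space -/

section Frechet

variable {E F : Type*} [NormedAddCommGroup E] [NormedSpace ℝ E]
  [NormedAddCommGroup F] [NormedSpace ℝ F]

theorem schwartz_exists_tsum [CompleteSpace F] (d : ℕ → 𝓢(E, F))
    (hd : ∀ k l : ℕ, Summable fun i => SchwartzMap.seminorm ℝ k l (d i)) :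
    ∃ S : 𝓢(E, F), (∀ x, S x = ∑' i, d i x) ∧
      ∀ k l : ℕ, SchwartzMap.seminorm ℝ k l S ≤ ∑' i, SchwartzMap.seminorm ℝ k l (d i) := by
  have h1 : ∀ (k : ℕ) (i : ℕ) (x : E), (k : ℕ∞) ≤ (⊤ : ℕ∞) →
      ‖iteratedFDeriv ℝ k (d i) x‖ ≤ SchwartzMap.seminorm ℝ 0 k (d i) :=
    fun k i x _ => SchwartzMap.norm_iteratedFDeriv_le_seminorm ℝ (d i) k x
  have hc : ∀ i, ContDiff ℝ ((⊤ : ℕ∞) : WithTop ℕ∞) (d i) := fun i => (d i).smooth ⊤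
  have hS : ContDiff ℝ ((⊤ : ℕ∞) : WithTop ℕ∞) fun x => ∑' i, d i x :=
    contDiff_tsum hc (fun k _ => hd 0 k) h1
  have hb : ∀ (k l : ℕ) (x : E), ‖x‖ ^ k * ‖iteratedFDeriv ℝ l (fun x => ∑' i, d i x) x‖ ≤
      ∑' i, SchwartzMap.seminorm ℝ k l (d i) := by
    intro k l x
    rw [iteratedFDeriv_tsum_apply hc (fun k _ => hd 0 k) h1 le_top]
    have hs : Summable fun i => ‖iteratedFDeriv ℝ l (d i) x‖ :=
      (hd 0 l).of_nonneg_of_le (fun _ => norm_nonneg _) fun i => h1 l i x le_top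
    calc ‖x‖ ^ k * ‖∑' i, iteratedFDeriv ℝ l (d i) x‖
        ≤ ‖x‖ ^ k * ∑' i, ‖iteratedFDeriv ℝ l (d i) x‖ := by
          gcongr
          exact norm_tsum_le_tsum_norm hs
      _ = ∑' i, ‖x‖ ^ k * ‖iteratedFDeriv ℝ l (d i) x‖ := tsum_mul_left.symm
      _ ≤ _ := (hs.mul_left _).tsum_le_tsum (fun i => (d i).le_seminorm ℝ k l x) (hd k l)
  refine ⟨⟨fun x => ∑' i, d i x, hS, fun k l => ⟨_, hb k l⟩⟩, fun x => rfl, fun k l => ?_⟩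
  exact SchwartzMap.seminorm_le_bound ℝ k l _ (tsum_nonneg fun i => apply_nonneg _ _) (hb k l)

instance schwartz_uniformity_countable : (uniformity 𝓢(E, F)).IsCountablyGenerated :=
  IsUniformAddGroup.uniformity_countably_generated

instance schwartz_completeSpace [CompleteSpace F] : CompleteSpace 𝓢(E, F) := by
  refine UniformSpace.complete_of_convergent_controlled_sequences
    (fun N => {p | ∀ k ∈ Set.Iic N, ∀ l ∈ Set.Iic N,
      SchwartzMap.seminorm ℝ k l (p.2 - p.1) < (1 / 2) ^ N}) (fun N => ?_) fun u hu => ?_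
  · rw [uniformity_eq_comap_nhds_zero]
    refine Filter.mem_comap.2 ⟨{x | ∀ k ∈ Set.Iic N, ∀ l ∈ Set.Iic N,
      SchwartzMap.seminorm ℝ k l x < (1 / 2) ^ N}, ?_, fun p hp => hp⟩
    change ∀ᶠ x in 𝓝 (0 : 𝓢(E, F)), _
    rw [Filter.eventually_all_finite (Set.finite_Iic N)]
    intro k _
    rw [Filter.eventually_all_finite (Set.finite_Iic N)]
    intro l _
    have hc : Continuous (SchwartzMap.seminorm ℝ k l : 𝓢(E, F) → ℝ) :=
      (schwartz_withSeminorms ℝ E F).continuous_seminorm (k, l)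
    refine hc.continuousAt.eventually_lt continuousAt_const ?_
    simp
  · set d : ℕ → 𝓢(E, F) := fun i => u (i + 1) - u i with hdd
    have hd : ∀ k l : ℕ, Summable fun i => SchwartzMap.seminorm ℝ k l (d i) := by
      intro k l
      rw [← summable_nat_add_iff (max k l)]
      refine ((summable_nat_add_iff (max k l)).2
        (summable_geometric_of_lt_one (r := (1 / 2 : ℝ)) (by norm_num)
          (by norm_num))).of_nonneg_of_le (fun _ => apply_nonneg _ _) fun i => ?_
      refine (hu (i + max k l) (i + max k l) (i + max k l + 1) le_rfl (Nat.le_succ _) k ?_ l ?_).le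
      · simp only [Set.mem_Iic]; omega
      · simp only [Set.mem_Iic]; omega
    obtain ⟨S, hS, -⟩ := schwartz_exists_tsum d hd
    refine ⟨S + u 0, (schwartz_withSeminorms ℝ E F).tendsto_nhds_atTop _ _ |>.2 ?_⟩
    rintro ⟨k, l⟩ ε hε
    have ht := tendsto_sum_nat_add fun i => SchwartzMap.seminorm ℝ k l (d i)
    obtain ⟨N₀, hN₀⟩ := (ht.eventually (gt_mem_nhds hε)).exists_forall_of_atTop
    refine ⟨N₀, fun N hN => ?_⟩
    obtain ⟨R, hR, hRs⟩ := schwartz_exists_tsum (fun i => d (i + N))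
      fun k l => (summable_nat_add_iff N).2 (hd k l)
    have hkey : u N - (S + u 0) = -R := by
      ext x
      have hsx : Summable fun i => d i x :=
        (Summable.of_nonneg_of_le (fun _ => norm_nonneg _)
          (fun i => SchwartzMap.norm_le_seminorm ℝ (d i) x) (hd 0 0)).of_norm
      have h2 := hsx.sum_add_tsum_nat_add N
      have h3 : ∑ i ∈ Finset.range N, d i x = u N x - u 0 x := by
        simpa [hdd] using Finset.sum_range_sub (fun i => u i x) N
      simp only [sub_apply, add_apply, neg_apply, hS, hR]
      rw [← h2, h3]
      abel
    rw [hkey, map_neg_eq_map]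
    exact (hRs k l).trans_lt (hN₀ N hN)

instance schwartz_baireSpace [CompleteSpace F] : BaireSpace 𝓢(E, F) := by
  let := UniformSpace.pseudoMetricSpace 𝓢(E, F)
  infer_instance

end Frechet

/-! ### Maps between Schwartz spaces which are pointwise continuous are continuous -/

section ClosedGraph

open LineDeriv

variable {𝕜 : Type*} [RCLike 𝕜]
variable {E D : Type*} [NormedAddCommGroup E] [NormedSpace ℝ E]
  [NormedAddCommGroup D] [NormedSpace ℝ D]

theorem schwartz_continuous_eval_lineDeriv (T : 𝓢(E, 𝕜) →ₗ[𝕜] 𝓢(D, 𝕜))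
    (hT : ∀ x, Continuous fun φ => T φ x) (w x : D) :
    Continuous fun φ => (∂_{w} (T φ) : 𝓢(D, 𝕜)) x := by
  let ev : D → 𝓢(E, 𝕜) →L[𝕜] 𝕜 := fun y =>
    { toFun := fun φ => T φ y
      map_add' := fun _ _ => by simp
      map_smul' := fun _ _ => by simp
      cont := hT y }
  let g : ℝ → 𝓢(E, 𝕜) →L[𝕜] 𝕜 := fun t => ((t⁻¹ : ℝ) : 𝕜) • (ev (x + t • w) - ev x)
  have h : Filter.Tendsto (fun t φ => g t φ) (𝓝[≠] (0 : ℝ))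
      (𝓝 fun φ => (∂_{w} (T φ) : 𝓢(D, 𝕜)) x) := by
    refine tendsto_pi_nhds.2 fun φ => ?_
    have h1 := (((T φ).differentiableAt (x := x)).lineDifferentiableAt
      (v := w)).hasLineDerivAt.tendsto_slope_zero
    rw [← SchwartzMap.lineDerivOp_apply] at h1
    refine h1.congr fun t => ?_
    simp [g, ev, RCLike.real_smul_eq_coe_mul]
  exact (continuousLinearMapOfTendsto g h).continuous

theorem schwartz_continuous_eval_iteratedLineDeriv {l : ℕ} (m : Fin l → D) (x : D) :
    ∀ (T : 𝓢(E, 𝕜) →ₗ[𝕜] 𝓢(D, 𝕜)), (∀ y, Continuous fun φ => T φ y) →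
      Continuous fun φ => (∂^{m} (T φ) : 𝓢(D, 𝕜)) x := by
  induction l with
  | zero => intro T hT; simpa using hT x
  | succ l ih =>
    intro T hT
    simp only [iteratedLineDerivOp_succ_right]
    exact ih (Fin.init m)
      ((lineDerivOpCLM 𝕜 𝓢(D, 𝕜) (m (Fin.last l))).toLinearMap.comp T)
      fun y => schwartz_continuous_eval_lineDeriv T hT _ y

theorem schwartz_continuous_of_continuous_eval (T : 𝓢(E, 𝕜) →ₗ[𝕜] 𝓢(D, 𝕜))
    (hT : ∀ x, Continuous fun φ => T φ x) : Continuous T := by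
  refine WithSeminorms.continuous_of_continuous_comp (schwartz_withSeminorms 𝕜 D 𝕜) T ?_
  rintro ⟨k, l⟩
  let ev : D × (Fin l → D) → 𝓢(E, 𝕜) →ₗ[𝕜] 𝕜 := fun i =>
    { toFun := fun φ => (((‖i.1‖ ^ k * (∏ j, ‖i.2 j‖)⁻¹ : ℝ)) : 𝕜) *
        iteratedFDeriv ℝ l (T φ) i.1 i.2
      map_add' := fun φ ψ => by
        simp only [← SchwartzMap.iteratedLineDerivOp_eq_iteratedFDeriv, map_add,
          iteratedLineDerivOp_add, add_apply, mul_add]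
      map_smul' := fun c φ => by
        simp only [← SchwartzMap.iteratedLineDerivOp_eq_iteratedFDeriv, map_smul,
          iteratedLineDerivOp_smul, smul_apply, smul_eq_mul, RingHom.id_apply]
        ring }
  let p : D × (Fin l → D) → Seminorm 𝕜 𝓢(E, 𝕜) := fun i => (normSeminorm 𝕜 𝕜).comp (ev i)
  have hp : ∀ i φ, p i φ = ‖i.1‖ ^ k * (∏ j, ‖i.2 j‖)⁻¹ * ‖iteratedFDeriv ℝ l (T φ) i.1 i.2‖ := by
    intro i φ
    have h0 : (0 : ℝ) ≤ ‖i.1‖ ^ k * (∏ j, ‖i.2 j‖)⁻¹ := by positivity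
    change ‖(((‖i.1‖ ^ k * (∏ j, ‖i.2 j‖)⁻¹ : ℝ)) : 𝕜) *
        iteratedFDeriv ℝ l (T φ) i.1 i.2‖ = _
    rw [norm_mul, RCLike.norm_ofReal, abs_of_nonneg h0]
  have hpc : ∀ i, Continuous (p i) := by
    intro i
    have h1 : Continuous (ev i) := by
      have h2 := schwartz_continuous_eval_iteratedLineDeriv i.2 i.1 T hT
      simp only [SchwartzMap.iteratedLineDerivOp_eq_iteratedFDeriv] at h2
      exact continuous_const.mul h2
    exact continuous_norm.comp h1
  have hple : ∀ i φ, p i φ ≤ SchwartzMap.seminorm 𝕜 k l (T φ) := by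
    intro i φ
    rw [hp]
    refine le_trans ?_ ((T φ).le_seminorm 𝕜 k l i.1)
    rw [mul_assoc]
    gcongr
    have h3 := (iteratedFDeriv ℝ l (T φ) i.1).le_opNorm i.2
    rcases (Finset.prod_nonneg fun j (_ : j ∈ Finset.univ) => norm_nonneg (i.2 j)).eq_or_lt
      with h0 | h0
    · rw [← h0]; simp
    · rw [inv_mul_le_iff₀ h0, mul_comm]; exact h3
  have hbdd : BddAbove (Set.range p) := by
    rw [Seminorm.bddAbove_range_iff]
    exact fun φ => ⟨_, by rintro _ ⟨i, rfl⟩; exact hple i φ⟩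
  have hsup : Continuous (⨆ i, p i : Seminorm 𝕜 𝓢(E, 𝕜)) := by
    rw [Seminorm.coe_iSup_eq hbdd]
    exact Seminorm.continuous_iSup p hpc hbdd
  refine Seminorm.continuous_of_le hsup fun φ => ?_
  have hle : ∀ i, p i φ ≤ (⨆ i, p i) φ := fun i => le_ciSup hbdd i φ
  refine SchwartzMap.seminorm_le_bound 𝕜 k l (T φ) (apply_nonneg _ _) fun x => ?_
  have h4 : ‖((‖x‖ ^ k : ℝ)) • iteratedFDeriv ℝ l (T φ) x‖ ≤ (⨆ i, p i) φ := by
    refine ContinuousMultilinearMap.opNorm_le_bound (apply_nonneg _ _) fun m => ?_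
    rcases (Finset.prod_nonneg fun j (_ : j ∈ Finset.univ) => norm_nonneg (m j)).eq_or_lt
      with h0 | h0
    · obtain ⟨j, -, hj⟩ := Finset.prod_eq_zero_iff.1 h0.symm
      rw [ContinuousMultilinearMap.map_coord_zero _ j (norm_eq_zero.1 hj)]
      simp [← h0]
    · have h5 := hle (x, m)
      rw [hp] at h5
      simp only at h5
      rw [smul_apply, norm_smul, Real.norm_of_nonneg (by positivity)]
      calc ‖x‖ ^ k * ‖iteratedFDeriv ℝ l (T φ) x m‖
          = (‖x‖ ^ k * (∏ j, ‖m j‖)⁻¹ * ‖iteratedFDeriv ℝ l (T φ) x m‖) * ∏ j, ‖m j‖ := by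
            field_simp
        _ ≤ _ := by gcongr
  rwa [norm_smul, Real.norm_of_nonneg (by positivity)] at h4

end ClosedGraph

/-! ### Families of class `𝓢` and their superpositions -/

/-- The space `𝓢ₙ` of rapidly decreasing smooth functions on `ℝⁿ` with values in the scalar
field `𝕜` (`ℝ` or `ℂ`), with its usual Fréchet topology. -/
abbrev TestSpace (𝕜 : Type*) [RCLike 𝕜] (n : ℕ) : Type _ :=
  𝓢(EuclideanSpace ℝ (Fin n), 𝕜)

/-- The space `𝓢'ₙ` of tempered distributions on `ℝⁿ`. Its default topology is the strong
topology `β(𝓢'ₙ)` (uniform convergence on the bounded subsets of `𝓢ₙ`); the type synonym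
`WeakDual 𝕜 (TestSpace 𝕜 n)` carries the weak* topology `σ(𝓢'ₙ)`. -/
abbrev TemperedDual (𝕜 : Type*) [RCLike 𝕜] (n : ℕ) : Type _ :=
  StrongDual 𝕜 (TestSpace 𝕜 n)

/-- A family `v = (v_p)` of tempered distributions on `ℝⁿ` indexed by `p ∈ ℝᵐ` is of class `𝓢`
if for every test function `φ` the function `p ↦ v_p(φ)` belongs to `𝓢ₘ`. -/
structure SFamily (𝕜 : Type*) [RCLike 𝕜] (m n : ℕ) where
  /-- The members of the family. -/
  toFun : EuclideanSpace ℝ (Fin m) → TemperedDual 𝕜 n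
  exists_schwartz' : ∀ φ : TestSpace 𝕜 n, ∃ g : TestSpace 𝕜 m, ∀ p, g p = toFun p φ

namespace SFamily

variable {𝕜 : Type*} [RCLike 𝕜] {m n : ℕ}

/-- The operator `v̂ : 𝓢ₙ → 𝓢ₘ`, `v̂(φ)(p) = v_p(φ)`, as a linear map. -/
def hatLinear (v : SFamily 𝕜 m n) : TestSpace 𝕜 n →ₗ[𝕜] TestSpace 𝕜 m where
  toFun φ := (v.exists_schwartz' φ).choose
  map_add' φ ψ := by
    ext p
    rw [add_apply, (v.exists_schwartz' (φ + ψ)).choose_spec, (v.exists_schwartz' φ).choose_spec,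
      (v.exists_schwartz' ψ).choose_spec, map_add]
  map_smul' c φ := by
    ext p
    rw [RingHom.id_apply, smul_apply, (v.exists_schwartz' (c • φ)).choose_spec,
      (v.exists_schwartz' φ).choose_spec, map_smul]

theorem hatLinear_apply (v : SFamily 𝕜 m n) (φ : TestSpace 𝕜 n) (p : EuclideanSpace ℝ (Fin m)) :
    v.hatLinear φ p = v.toFun p φ :=
  (v.exists_schwartz' φ).choose_spec p

/-- The operator `v̂ : 𝓢ₙ → 𝓢ₘ`, `v̂(φ)(p) = v_p(φ)`; it is automatically continuous. -/
def hat (v : SFamily 𝕜 m n) : TestSpace 𝕜 n →L[𝕜] TestSpace 𝕜 m where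
  toLinearMap := v.hatLinear
  cont := schwartz_continuous_of_continuous_eval v.hatLinear fun p => by
    simpa only [hatLinear_apply] using (v.toFun p).continuous

@[simp]
theorem hat_apply (v : SFamily 𝕜 m n) (φ : TestSpace 𝕜 n) (p : EuclideanSpace ℝ (Fin m)) :
    v.hat φ p = v.toFun p φ :=
  v.hatLinear_apply φ p

/-- The operator `v̂` regarded as a map between the spaces `𝓢ₙ`, `𝓢ₘ` endowed with their weak
topologies `σ(𝓢ₙ)`, `σ(𝓢ₘ)`. -/
def hatWeak (v : SFamily 𝕜 m n) :
    WeakSpace 𝕜 (TestSpace 𝕜 n) →ₗ[𝕜] WeakSpace 𝕜 (TestSpace 𝕜 m) :=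
  (toWeakSpace 𝕜 (TestSpace 𝕜 m)).toLinearMap ∘ₗ v.hatLinear ∘ₗ
    (toWeakSpace 𝕜 (TestSpace 𝕜 n)).symm.toLinearMap

/-- The superposition operator `a ↦ ∫ a v` from `𝓢'ₘ` to `𝓢'ₙ`, where the superposition of `v`
with coefficient system `a` is the distribution `(∫ a v)(φ) = a(v̂(φ))`. -/
def superposition (v : SFamily 𝕜 m n) : TemperedDual 𝕜 m →ₗ[𝕜] TemperedDual 𝕜 n where
  toFun a := a.comp v.hat
  map_add' a b := ContinuousLinearMap.add_comp a b v.hat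
  map_smul' c a := ContinuousLinearMap.smul_comp c a v.hat

@[simp]
theorem superposition_apply (v : SFamily 𝕜 m n) (a : TemperedDual 𝕜 m) (φ : TestSpace 𝕜 n) :
    v.superposition a φ = a (v.hat φ) := rfl

/-- The superposition operator regarded as a map between the spaces `𝓢'ₘ`, `𝓢'ₙ` endowed with
their weak* topologies `σ(𝓢'ₘ)`, `σ(𝓢'ₙ)`. -/
def superpositionWeak (v : SFamily 𝕜 m n) :
    WeakDual 𝕜 (TestSpace 𝕜 m) →ₗ[𝕜] WeakDual 𝕜 (TestSpace 𝕜 n) :=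
  StrongDual.toWeakDual.toLinearMap ∘ₗ v.superposition ∘ₗ
    StrongDual.toWeakDual.symm.toLinearMap

/-- The family `v` is `𝓢`-linearly independent if `∫ a v = 0` only for `a = 0`. -/
def SLinearIndependent (v : SFamily 𝕜 m n) : Prop :=
  ∀ a : TemperedDual 𝕜 m, v.superposition a = 0 → a = 0

/-- The `𝓢`-linear hull of `v`: the subspace of all superpositions `∫ a v`, `a ∈ 𝓢'ₘ`. -/
def sSpan (v : SFamily 𝕜 m n) : Submodule 𝕜 (TemperedDual 𝕜 n) :=
  LinearMap.range v.superposition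

/-- The family `v` is topologically exhaustive if its `𝓢`-linear hull is closed in the weak*
topology `σ(𝓢'ₙ)`. -/
def TopologicallyExhaustive (v : SFamily 𝕜 m n) : Prop :=
  IsClosed (StrongDual.toWeakDual '' (v.sSpan : Set (TemperedDual 𝕜 n)))

end SFamily

/-- A topological homomorphism between topological vector spaces (a strict morphism in the sense of
Bourbaki): a continuous linear map which is open onto its image, the image carrying the topology
induced by the codomain. -/
def IsTopologicalHom {𝕜 E F : Type*} [Ring 𝕜] [AddCommGroup E] [Module 𝕜 E]
    [TopologicalSpace E] [AddCommGroup F] [Module 𝕜 F] [TopologicalSpace F]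
    (u : E →ₗ[𝕜] F) : Prop :=
  Topology.IsStrictMap u

theorem isTopologicalHom_iff {𝕜 E F : Type*} [Ring 𝕜] [AddCommGroup E] [Module 𝕜 E]
    [TopologicalSpace E] [IsTopologicalAddGroup E] [AddCommGroup F] [Module 𝕜 F]
    [TopologicalSpace F] (u : E →ₗ[𝕜] F) :
    IsTopologicalHom u ↔ Continuous u ∧ IsOpenMap (Set.rangeFactorization u) := by
  constructor
  · intro h
    exact ⟨Topology.IsStrictMap.continuous h,
      (u.isStrictMap_iff_isOpenQuotientMap_rangeRestrict.1 h).isOpenMap⟩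
  · rintro ⟨hc, ho⟩
    exact ho.isQuotientMap hc.rangeFactorization Set.rangeFactorization_surjective

end

/-!
The operator `T = v̂ : 𝓢ₙ → 𝓢ₘ` is a continuous linear map between Fréchet spaces, and the
superposition operator is its transpose `T'`. Each of the assertions contains the injectivity of
`T'`, directly or through the surjectivity of `T`, so that everything rests on one implication: if
`T'` is injective with weak* closed range, then `T` is open, hence onto. The other
properties of `T` and `T'` are then read off from this.

*Openness of `T`.* Let `U` be the unit ball of a continuous seminorm of `𝓢ₙ`, and `U°` its polar.
By Banach–Alaoglu, `H = U° ∩ range T'` is weak* compact. The dual of `𝓢ₘ` is the union of the polars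
`Vₖ°` of a countable basis of neighbourhoods, so the compact sets `T'(Vₖ°)` cover `H`; by Baire's
theorem one of them has interior in `H`, and since `H` is convex and symmetric, `T'(Vₖ°)` contains
a multiple of `H`. As `T'` is injective, `(T')⁻¹(U°)` is equicontinuous
(`ContinuousLinearMap.exists_seminorm_forall_le_of_isClosed_range`). By Hahn–Banach this means that
the closure of `T(U)` is a neighbourhood of zero
(`ContinuousLinearMap.closure_image_mem_nhds_of_isClosed_range`), and successive approximation in
the complete space `𝓢ₙ` removes the closure (`AddMonoidHom.isOpenMap_of_closure_image_mem_nhds`).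

*Weak topologies.* If `T` is onto, the weak* topology of the dual of `𝓢ₘ` is induced through `T'`,
because every evaluation at a point of `𝓢ₘ` is an evaluation at a point of `𝓢ₙ`. If moreover `T` is
open, it is weakly open: a weak neighbourhood involves finitely many functionals, and a projection
of `𝕜ʳ` with kernel the image of `ker T` turns them into functionals which factor through `T`
(`ContinuousLinearMap.isOpenMap_weakSpaceMap`).

*Strong topologies.* For `T'` to induce the strong topology, bounded sets of `𝓢ₘ` have to be lifted
to bounded sets of `𝓢ₙ`, at least up to closure. For quotients of general Fréchet spaces this fails;
here it holds since bounded subsets of `𝓢ₘ` are totally bounded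
(`SchwartzMap.totallyBounded_of_isVonNBounded`), and totally bounded sets can be lifted
(`ContinuousLinearMap.exists_isVonNBounded_subset_closure_image`).
-/

/-! ### Seminorms and polars -/

section Seminorms

variable {𝕜 : Type*} [RCLike 𝕜] {E F : Type*} [AddCommGroup E] [Module 𝕜 E]
  [AddCommGroup F] [Module 𝕜 F]

theorem Seminorm.le_of_forall_lt_one {p q : Seminorm 𝕜 E} (h : ∀ x, p x < 1 → q x ≤ 1) :
    q ≤ p := by
  intro x
  refine le_of_forall_gt_imp_ge_of_dense fun r hr => ?_
  have hr0 : 0 < r := (apply_nonneg p x).trans_lt hr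
  have hn : ‖((r⁻¹ : ℝ) : 𝕜)‖ = r⁻¹ := by
    rw [RCLike.norm_ofReal, abs_of_pos (inv_pos.2 hr0)]
  have h1 := h (((r⁻¹ : ℝ) : 𝕜) • x) (by
    rw [map_smul_eq_mul, hn, inv_mul_lt_iff₀ hr0, mul_one]; exact hr)
  rwa [map_smul_eq_mul, hn, inv_mul_le_iff₀ hr0, mul_one] at h1

variable [TopologicalSpace E] [TopologicalSpace F]

theorem Seminorm.exists_continuous_eq_mul {q : Seminorm 𝕜 E} (hq : Continuous q) {r : ℝ}
    (hr : 0 ≤ r) : ∃ q' : Seminorm 𝕜 E, Continuous q' ∧ ∀ x, q' x = r * q x := by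
  have h : ∀ x, (r.toNNReal • q) x = r * q x := fun x => by
    rw [smul_apply, NNReal.smul_def, Real.coe_toNNReal r hr, smul_eq_mul]
  refine ⟨r.toNNReal • q, ?_, h⟩
  rw [funext h]
  exact continuous_const.mul hq

theorem PolynormableSpace.exists_seminorm_ball_subset [IsTopologicalAddGroup E]
    [PolynormableSpace 𝕜 E] {U : Set E}
    (hU : U ∈ 𝓝 0) : ∃ p : Seminorm 𝕜 E, Continuous p ∧ p.ball 0 1 ⊆ U := by
  obtain ⟨⟨s, r⟩, hr, hs⟩ := (PolynormableSpace.withSeminorms 𝕜 E).hasBasis_zero_ball.mem_iff.1 hU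
  have hc : Continuous ⇑(s.sup fun p : {p : Seminorm 𝕜 E // Continuous p} => (p : Seminorm 𝕜 E)) :=
    Seminorm.continuous_finsetSup fun i _ => i.2
  obtain ⟨q, hq, hqe⟩ := Seminorm.exists_continuous_eq_mul hc (inv_pos.2 hr).le
  refine ⟨q, hq, fun x hx => hs ?_⟩
  rw [Seminorm.mem_ball_zero] at hx ⊢
  rwa [hqe, inv_mul_lt_iff₀ hr, mul_one] at hx

/-- In a first countable space, a single increasing sequence of seminorms has the unit balls as a
basis of neighbourhoods of zero, without rescaling the radii. -/
theorem PolynormableSpace.exists_seq_seminorm (𝕜 E : Type*) [RCLike 𝕜] [AddCommGroup E] [Module 𝕜 E]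
    [TopologicalSpace E] [IsTopologicalAddGroup E] [PolynormableSpace 𝕜 E]
    [FirstCountableTopology E] :
    ∃ p : ℕ → Seminorm 𝕜 E, Monotone p ∧ (∀ n, Continuous (p n)) ∧
      ∀ U ∈ 𝓝 (0 : E), ∃ n, (p n).ball 0 1 ⊆ U := by
  obtain ⟨V, hV⟩ := (𝓝 (0 : E)).exists_antitone_basis
  choose p hpc hp using fun n =>
    PolynormableSpace.exists_seminorm_ball_subset (𝕜 := 𝕜) (hV.1.mem_of_mem (i := n) trivial)
  refine ⟨fun n => (Finset.range (n + 1)).sup p, fun a b hab => Finset.sup_mono ?_, fun n => ?_,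
    fun U hU => ?_⟩
  · exact Finset.range_mono (by omega)
  · exact Seminorm.continuous_finsetSup fun i _ => hpc i
  · obtain ⟨n, -, hn⟩ := hV.1.mem_iff.1 hU
    refine ⟨n, fun x hx => hn (hp n ?_)⟩
    rw [Seminorm.mem_ball_zero] at hx ⊢
    exact (Finset.le_sup (f := p) (Finset.self_mem_range_succ n) x).trans_lt hx

/-- The Banach–Alaoglu theorem for a topological vector space: the functionals dominated by a
continuous seminorm form a weak* compact set. -/
theorem WeakDual.isCompact_setOf_le_seminorm [IsTopologicalAddGroup E] {p : Seminorm 𝕜 E}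
    (hp : Continuous p) : IsCompact {f : WeakDual 𝕜 E | ∀ x, ‖f x‖ ≤ p x} := by
  have hind : Topology.IsInducing fun (f : WeakDual 𝕜 E) (x : E) => f x := ⟨rfl⟩
  rw [hind.isCompact_iff]
  have himage : (fun (f : WeakDual 𝕜 E) (x : E) => f x) '' {f | ∀ x, ‖f x‖ ≤ p x} =
      (Set.univ.pi fun x => Metric.closedBall (0 : 𝕜) (p x)) ∩
        Set.range (DFunLike.coe : (E →ₗ[𝕜] 𝕜) → E → 𝕜) := by
    ext g
    constructor
    · rintro ⟨f, hf, rfl⟩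
      exact ⟨fun x _ => by simpa using hf x, ⟨(f : E →L[𝕜] 𝕜).toLinearMap, rfl⟩⟩
    · rintro ⟨hg, L, rfl⟩
      have hL : ∀ x, ‖L x‖ ≤ p x := fun x => by simpa using hg x trivial
      refine ⟨(⟨L, ?_⟩ : E →L[𝕜] 𝕜), hL, rfl⟩
      refine continuous_of_continuousAt_zero L ?_
      rw [ContinuousAt, map_zero]
      refine squeeze_zero_norm hL ?_
      simpa using hp.tendsto 0
  have hcl : IsClosed (Set.range (DFunLike.coe : (E →ₗ[𝕜] 𝕜) → E → 𝕜)) :=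
    LinearMap.isClosed_range_coe E 𝕜 (σ := RingHom.id 𝕜)
  have hcp : IsCompact (Set.univ.pi fun x : E => Metric.closedBall (0 : 𝕜) (p x)) :=
    isCompact_univ_pi fun x => ProperSpace.isCompact_closedBall _ _
  rw [himage]
  exact hcp.inter_right hcl

end Seminorms

/-! ### Maps with an injective transpose of weak* closed range -/

section ClosedRange

variable {𝕜 : Type*} [RCLike 𝕜] {E F : Type*} [AddCommGroup E] [Module 𝕜 E] [TopologicalSpace E]
  [AddCommGroup F] [Module 𝕜 F] [TopologicalSpace F]

namespace ContinuousLinearMap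

/-- The transpose of a continuous linear map, between the duals with their weak* topologies. -/
def weakTranspose (T : E →L[𝕜] F) : WeakDual 𝕜 F →L[𝕜] WeakDual 𝕜 E where
  toFun a := (a : F →L[𝕜] 𝕜).comp T
  map_add' a b := ContinuousLinearMap.add_comp (a : F →L[𝕜] 𝕜) b T
  map_smul' c a := ContinuousLinearMap.smul_comp c (a : F →L[𝕜] 𝕜) T
  cont := WeakDual.continuous_of_continuous_eval fun x => WeakDual.eval_continuous (T x)

/-- If the transpose of `T` is injective and has weak* closed range, then the preimage of an
equicontinuous set under the transpose is equicontinuous. -/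
theorem exists_seminorm_forall_le_of_isClosed_range [IsTopologicalAddGroup E]
    [IsTopologicalAddGroup F] [PolynormableSpace 𝕜 F] [FirstCountableTopology F] (T : E →L[𝕜] F)
    (hinj : Function.Injective T.weakTranspose) (hcl : IsClosed (Set.range T.weakTranspose))
    {p : Seminorm 𝕜 E} (hp : Continuous p) :
    ∃ q : Seminorm 𝕜 F, Continuous q ∧
      ∀ a : WeakDual 𝕜 F, (∀ x, ‖a (T x)‖ ≤ p x) → ∀ y, ‖a y‖ ≤ q y := by
  obtain ⟨q, -, hqc, hq⟩ := PolynormableSpace.exists_seq_seminorm 𝕜 F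
  set H : Set (WeakDual 𝕜 E) := {f | ∀ x, ‖f x‖ ≤ p x} ∩ Set.range T.weakTranspose
  have hHc : IsCompact H := (WeakDual.isCompact_setOf_le_seminorm hp).inter_right hcl
  set K : ℕ → Set (WeakDual 𝕜 E) := fun n => T.weakTranspose '' {a | ∀ y, ‖a y‖ ≤ q n y}
  have hKc : ∀ n, IsClosed (K n) := fun n =>
    ((WeakDual.isCompact_setOf_le_seminorm (hqc n)).image T.weakTranspose.continuous).isClosed
  have h0 : (0 : WeakDual 𝕜 E) ∈ H := ⟨fun x => by
    change ‖(0 : 𝕜)‖ ≤ p x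
    rw [norm_zero]; exact apply_nonneg _ _, 0, map_zero _⟩
  have : CompactSpace H := isCompact_iff_compactSpace.1 hHc
  have : Nonempty H := ⟨⟨0, h0⟩⟩
  -- The polars of a fundamental sequence of neighbourhoods exhaust the dual of `F`.
  have hcover : ⋃ n, ((↑) : H → WeakDual 𝕜 E) ⁻¹' K n = Set.univ := by
    refine Set.eq_univ_of_forall fun ⟨f, hf, a, ha⟩ => Set.mem_iUnion.2 ?_
    have hU : {y | ‖a y‖ < 1} ∈ 𝓝 (0 : F) := by
      refine ((a : F →L[𝕜] 𝕜).continuous.norm.isOpen_preimage _ isOpen_Iio).mem_nhds ?_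
      change ‖(a : F →L[𝕜] 𝕜) 0‖ < 1
      simp
    obtain ⟨n, hn⟩ := hq _ hU
    refine ⟨n, a, fun y => ?_, ha⟩
    refine Seminorm.le_of_forall_lt_one
      (q := (normSeminorm 𝕜 𝕜).comp (a : F →L[𝕜] 𝕜).toLinearMap) (fun y hy => ?_) y
    exact (hn ((q n).mem_ball_zero.2 hy)).le
  obtain ⟨n, ⟨⟨h, hhH⟩, hh⟩⟩ :=
    nonempty_interior_of_iUnion_of_closed (fun n => (hKc n).preimage continuous_subtype_val) hcover
  obtain ⟨O, hO, hOK⟩ := mem_nhds_subtype _ _ _ |>.1 (mem_interior_iff_mem_nhds.1 hh)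
  -- By compactness a small homothety of centre `h` maps `H` into the interior found.
  have hev : ∀ᶠ t : ℝ in 𝓝 0, ∀ f ∈ H, h + (t : 𝕜) • (f - h) ∈ O := by
    refine hHc.eventually_forall_of_forall_eventually fun f _ => ?_
    have hc : Continuous fun z : ℝ × WeakDual 𝕜 E => h + (z.1 : 𝕜) • (z.2 - h) := by
      have := RCLike.continuous_ofReal (K := 𝕜)
      fun_prop
    refine hc.continuousAt.eventually_mem ?_
    simpa using hO
  obtain ⟨t, ht1, ht⟩ : ∃ t : ℝ, 0 < t ∧ t ≤ 1 ∧ ∀ f ∈ H, h + (t : 𝕜) • (f - h) ∈ O := by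
    obtain ⟨ε, hε, hball⟩ := Metric.eventually_nhds_iff.1 hev
    refine ⟨min (ε / 2) 1, by positivity, min_le_right _ _, hball ?_⟩
    rw [dist_zero_right, Real.norm_of_nonneg (by positivity)]
    exact (min_le_left _ _).trans_lt (half_lt_self hε)
  obtain ⟨ht2, ht⟩ := ht
  have hconv : ∀ f ∈ H, h + (t : 𝕜) • (f - h) ∈ H := by
    rintro f ⟨hf, a, rfl⟩
    obtain ⟨hh1, b, rfl⟩ := hhH
    refine ⟨fun x => ?_, b + (t : 𝕜) • (a - b), by
      rw [map_add, map_smul, map_sub]⟩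
    have e : (T.weakTranspose b + (t : 𝕜) • (T.weakTranspose a - T.weakTranspose b)) x =
        ((1 - t : ℝ) : 𝕜) * T.weakTranspose b x + (t : 𝕜) * T.weakTranspose a x := by
      change T.weakTranspose b x + (t : 𝕜) * (T.weakTranspose a x - T.weakTranspose b x) = _
      push_cast
      ring
    rw [e]
    refine (norm_add_le _ _).trans ?_
    rw [norm_mul, norm_mul, RCLike.norm_ofReal, RCLike.norm_ofReal, abs_of_pos ht1,
      abs_of_nonneg (sub_nonneg.2 ht2)]
    nlinarith [hf x, hh1 x]
  have hmem : ∀ f ∈ H, h + (t : 𝕜) • (f - h) ∈ K n := fun f hf =>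
    @hOK ⟨_, hconv f hf⟩ (ht f hf)
  obtain ⟨q', hq'c, hq'⟩ := Seminorm.exists_continuous_eq_mul (hqc n) (inv_pos.2 ht1).le
  refine ⟨q', hq'c, fun a ha y => ?_⟩
  have h1 : T.weakTranspose a ∈ H := ⟨ha, a, rfl⟩
  have h2 : -T.weakTranspose a ∈ H := ⟨fun x => by
    change ‖-(a (T x))‖ ≤ p x
    rw [norm_neg]; exact ha x, -a, map_neg _ _⟩
  obtain ⟨b₁, hb₁, e₁⟩ := hmem _ h1
  obtain ⟨b₂, hb₂, e₂⟩ := hmem _ h2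
  -- Symmetry of `H` removes the centre `h`.
  have hab : ((2 * t : ℝ) : 𝕜) • a = b₁ - b₂ := by
    refine hinj ?_
    rw [map_smul, map_sub, e₁, e₂]
    push_cast
    module
  have h3 : ((2 * t : ℝ) : 𝕜) * a y = b₁ y - b₂ y := congrArg (fun f : WeakDual 𝕜 F => f y) hab
  have h4 : 2 * t * ‖a y‖ ≤ 2 * q n y := by
    calc 2 * t * ‖a y‖ = ‖((2 * t : ℝ) : 𝕜) * a y‖ := by
          rw [norm_mul, RCLike.norm_ofReal, abs_of_pos (by positivity)]
      _ ≤ ‖b₁ y‖ + ‖b₂ y‖ := by rw [h3]; exact norm_sub_le _ _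
      _ ≤ 2 * q n y := by linarith [hb₁ y, hb₂ y]
  rw [hq', le_inv_mul_iff₀ ht1]
  linarith

/-- If the transpose of `T` is injective and has weak* closed range, then `T` is almost open. -/
theorem closure_image_mem_nhds_of_isClosed_range [Module ℝ E] [IsScalarTower ℝ 𝕜 E]
    [Module ℝ F] [IsScalarTower ℝ 𝕜 F] [IsTopologicalAddGroup E] [PolynormableSpace 𝕜 E]
    [IsTopologicalAddGroup F] [ContinuousSMul 𝕜 F] [LocallyConvexSpace ℝ F]
    [PolynormableSpace 𝕜 F] [FirstCountableTopology F] (T : E →L[𝕜] F)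
    (hinj : Function.Injective T.weakTranspose) (hcl : IsClosed (Set.range T.weakTranspose))
    {U : Set E} (hU : U ∈ 𝓝 0) : closure (T '' U) ∈ 𝓝 0 := by
  obtain ⟨p, hpc, hp⟩ := PolynormableSpace.exists_seminorm_ball_subset (𝕜 := 𝕜) hU
  obtain ⟨q, hqc, hq⟩ := T.exists_seminorm_forall_le_of_isClosed_range hinj hcl hpc
  refine Filter.mem_of_superset (Seminorm.ball_mem_nhds hqc one_pos) fun y hy => ?_
  refine closure_mono (Set.image_mono hp) ?_
  by_contra hyn
  have : ContinuousSMul ℝ F := IsScalarTower.continuousSMul 𝕜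
  have hconv : Convex ℝ (closure (T '' p.ball 0 1)) :=
    ((p.convex_ball 0 1).linear_image (T.toLinearMap.restrictScalars ℝ)).closure
  obtain ⟨f, u, hf, hu⟩ :=
    RCLike.geometric_hahn_banach_closed_point (𝕜 := 𝕜) hconv isClosed_closure hyn
  have hf' : ∀ x, p x < 1 → RCLike.re (f (T x)) < u := fun x hx =>
    hf _ (subset_closure ⟨x, p.mem_ball_zero.2 hx, rfl⟩)
  have hu0 : 0 < u := by simpa using hf' 0 (by simp)
  have hn : ‖((u⁻¹ : ℝ) : 𝕜)‖ = u⁻¹ := by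
    rw [RCLike.norm_ofReal, abs_of_pos (inv_pos.2 hu0)]
  set a : F →L[𝕜] 𝕜 := ((u⁻¹ : ℝ) : 𝕜) • f
  have hale : ∀ x, ‖a (T x)‖ ≤ p x := by
    refine Seminorm.le_of_forall_lt_one
      (q := (normSeminorm 𝕜 𝕜).comp (a.comp T).toLinearMap) (fun x hx => ?_)
    change ‖((u⁻¹ : ℝ) : 𝕜) * f (T x)‖ ≤ 1
    rw [norm_mul, hn, inv_mul_le_iff₀ hu0, mul_one]
    -- Rotate `x` so that `f (T x)` becomes its modulus.
    obtain ⟨c, hc1, hc2⟩ := RCLike.exists_norm_eq_mul_self (f (T x))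
    have h1 := hf' (c • x) (by rw [map_smul_eq_mul, hc1, one_mul]; exact hx)
    rw [map_smul, map_smul, smul_eq_mul, ← hc2, RCLike.ofReal_re] at h1
    exact h1.le
  have h1 := hq (StrongDual.toWeakDual a) hale y
  have h2 : ‖a y‖ < 1 := h1.trans_lt (q.mem_ball_zero.1 hy)
  have h3 : ‖a y‖ = u⁻¹ * ‖f y‖ := by
    change ‖((u⁻¹ : ℝ) : 𝕜) * f y‖ = _
    rw [norm_mul, hn]
  rw [h3, inv_mul_lt_iff₀ hu0, mul_one] at h2
  exact absurd (hu.trans_le (RCLike.re_le_norm (f y))) h2.not_gt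

end ContinuousLinearMap

end ClosedRange

/-! ### Open maps between Fréchet spaces -/

/-- An almost open continuous homomorphism from a complete first countable group is open. -/
theorem AddMonoidHom.isOpenMap_of_closure_image_mem_nhds {E F : Type*} [AddCommGroup E]
    [UniformSpace E] [IsUniformAddGroup E] [CompleteSpace E] [FirstCountableTopology E]
    [AddCommGroup F] [TopologicalSpace F] [IsTopologicalAddGroup F] [T2Space F] (T : E →+ F)
    (hT : Continuous T) (h : ∀ U ∈ 𝓝 (0 : E), closure (T '' U) ∈ 𝓝 0) : IsOpenMap T := by
  rw [IsTopologicalAddGroup.isOpenMap_iff_nhds_zero]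
  intro U hU
  rw [Filter.mem_map] at hU
  obtain ⟨V, ⟨hV, hVc⟩, hVU⟩ := (closed_nhds_basis (0 : E)).mem_iff.1 hU
  obtain ⟨u, hu, huadd⟩ := IsTopologicalAddGroup.exists_antitone_basis_nhds_zero E
  obtain ⟨n, -, hn⟩ := hu.1.mem_iff.1 hV
  refine Filter.mem_of_superset (h (u (n + 1)) (hu.1.mem_of_mem trivial)) fun y hy => ?_
  have hstep : ∀ m : ℕ, ∀ z ∈ closure (T '' u m), ∃ x ∈ u m,
      z - T x ∈ closure (T '' u (m + 1)) := by
    intro m z hz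
    have h1 : {w | z - w ∈ closure (T '' u (m + 1))} ∈ 𝓝 z := by
      have hc : Continuous fun w => z - w := by fun_prop
      refine hc.continuousAt.preimage_mem_nhds ?_
      rw [sub_self]
      exact h _ (hu.1.mem_of_mem trivial)
    obtain ⟨_, hw, x, hx, rfl⟩ := mem_closure_iff_nhds.1 hz _ h1
    exact ⟨x, hx, hw⟩
  choose! g hg hg' using hstep
  -- `s k` is the approximate solution and `z k` is the error left after `k` steps.
  let z : ℕ → F := fun k => Nat.rec y (fun k z => z - T (g (n + 1 + k) z)) k
  let s : ℕ → E := fun k => ∑ i ∈ Finset.range k, g (n + 1 + i) (z i)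
  have hz : ∀ k, z k ∈ closure (T '' u (n + 1 + k)) := by
    intro k
    induction k with
    | zero => exact hy
    | succ k ih => exact hg' _ _ ih
  have hs : ∀ k, s (k + 1) = s k + g (n + 1 + k) (z k) := fun k => Finset.sum_range_succ _ _
  have hzs : ∀ k, T (s k) = y - z k := by
    intro k
    induction k with
    | zero => simp [s, z]
    | succ k ih =>
      rw [hs, map_add, ih]
      change _ = y - (z k - T (g (n + 1 + k) (z k)))
      abel
  have h0 : ∀ m, (0 : E) ∈ u m := fun m => mem_of_mem_nhds (hu.1.mem_of_mem trivial)
  have hdiff : ∀ j k, s (k + j) - s k ∈ u (n + k) := by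
    intro j
    induction j with
    | zero => intro k; simpa using h0 _
    | succ j ih =>
      intro k
      refine huadd (n + k)
        (Set.mem_add.2 ⟨g (n + 1 + k) (z k), ?_, s (k + 1 + j) - s (k + 1), ?_, ?_⟩)
      · rw [show n + k + 1 = n + 1 + k by omega]
        exact hg _ _ (hz k)
      · exact ih (k + 1)
      · rw [hs k, show k + 1 + j = k + (j + 1) by omega]
        abel
  have hcau : CauchySeq s := by
    rw [Filter.HasBasis.cauchySeq_iff' (hu.1.uniformity_of_nhds_zero_swapped)]
    intro m _
    refine ⟨m, fun k hk => ?_⟩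
    obtain ⟨j, rfl⟩ := Nat.exists_eq_add_of_le hk
    exact hu.2 (Nat.le_add_left m n) (hdiff j m)
  obtain ⟨x, hx⟩ := cauchySeq_tendsto_of_complete hcau
  have hxV : x ∈ V := hVc.mem_of_tendsto hx (Filter.Eventually.of_forall fun k => hn (by
    have := hdiff k 0
    simpa [s] using this))
  have hz0 : Filter.Tendsto z Filter.atTop (𝓝 0) := by
    refine (closed_nhds_basis (0 : F)).tendsto_right_iff.2 fun W hW => ?_
    have hW' : T ⁻¹' W ∈ 𝓝 0 := hT.continuousAt.preimage_mem_nhds (by rw [map_zero]; exact hW.1)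
    obtain ⟨N, -, hN⟩ := hu.1.mem_iff.1 hW'
    filter_upwards [Filter.eventually_ge_atTop N] with k hk
    refine closure_minimal ?_ hW.2 (hz k)
    exact Set.image_subset_iff.2 ((hu.2 (by omega : N ≤ n + 1 + k)).trans hN)
  have hy' : T x = y := by
    refine tendsto_nhds_unique ((hT.tendsto x).comp hx) ?_
    simp only [Function.comp_def, hzs]
    simpa using tendsto_const_nhds.sub hz0
  rw [← hy']
  exact hVU hxV

section Operators

variable {𝕜 : Type*} [RCLike 𝕜] {E F : Type*} [AddCommGroup E] [Module 𝕜 E] [TopologicalSpace E]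
  [AddCommGroup F] [Module 𝕜 F] [TopologicalSpace F]

namespace ContinuousLinearMap

/-- An open continuous linear map onto `F` remains open for the weak topologies. -/
theorem isOpenMap_weakSpaceMap [IsTopologicalAddGroup E] [IsTopologicalAddGroup F] (T : E →L[𝕜] F)
    (hsurj : Function.Surjective T) (hopen : IsOpenMap T) : IsOpenMap (WeakSpace.map T) := by
  rw [IsTopologicalAddGroup.isOpenMap_iff_nhds_zero]
  intro U hU
  rw [Filter.mem_map] at hU
  have hU2 : (WeakSpace.map T : E → F) ⁻¹' U ∈
      Filter.comap (fun (x : E) (f : StrongDual 𝕜 E) => f x) (𝓝 0) := by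
    have h1 : 𝓝 (0 : WeakSpace 𝕜 E) = Filter.comap (fun (x : E) (f : StrongDual 𝕜 E) => f x)
      (𝓝 fun f : StrongDual 𝕜 E => f 0) := nhds_induced _ _
    have h2 : (fun f : StrongDual 𝕜 E => f 0) = 0 := by ext f; simp
    rw [← h2, ← h1]
    exact hU
  obtain ⟨W, hW, hWU⟩ := hU2
  rw [nhds_pi, Filter.mem_pi] at hW
  obtain ⟨I, hI, S, hS, hSW⟩ := hW
  have : Finite I := hI
  let Φ : E →ₗ[𝕜] I → 𝕜 := LinearMap.pi fun i => (i : StrongDual 𝕜 E).toLinearMap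
  have hΦ : Continuous Φ := continuous_pi fun i => (i : StrongDual 𝕜 E).continuous
  -- A projection of the finite dimensional space `I → 𝕜` onto the image of `ker T`.
  obtain ⟨π, hπ⟩ := ((LinearMap.ker T.toLinearMap).map Φ).subtype.exists_leftInverse_of_injective
    (Submodule.ker_subtype _)
  have hπ' : ∀ v, ((π (Φ v) : (LinearMap.ker T.toLinearMap).map Φ) : I → 𝕜) ∈
    (LinearMap.ker T.toLinearMap).map Φ := fun v => (π (Φ v)).2
  let P : (I → 𝕜) →ₗ[𝕜] (I → 𝕜) := LinearMap.id - (Submodule.subtype _).comp π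
  have hker : LinearMap.ker T.toLinearMap ≤ LinearMap.ker (P.comp Φ) := by
    intro k hk
    have h1 : π (Φ k) = ⟨Φ k, Submodule.mem_map_of_mem hk⟩ :=
      LinearMap.congr_fun hπ ⟨Φ k, Submodule.mem_map_of_mem hk⟩
    rw [LinearMap.mem_ker]
    change Φ k - ((π (Φ k) : (LinearMap.ker T.toLinearMap).map Φ) : I → 𝕜) = 0
    rw [h1, sub_self]
  -- `P ∘ Φ` factors through `T`.
  let G : F →ₗ[𝕜] (I → 𝕜) := ((LinearMap.ker T.toLinearMap).liftQ (P.comp Φ) hker).comp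
    (T.toLinearMap.quotKerEquivOfSurjective hsurj).symm.toLinearMap
  have hG : ∀ x, G (T x) = P (Φ x) := fun x => by
    change (LinearMap.ker T.toLinearMap).liftQ (P.comp Φ) hker
      ((T.toLinearMap.quotKerEquivOfSurjective hsurj).symm (T x)) = _
    have : (T.toLinearMap.quotKerEquivOfSurjective hsurj).symm (T x) =
        (LinearMap.ker T.toLinearMap).mkQ x := by
      rw [LinearEquiv.symm_apply_eq]; rfl
    rw [this]; rfl
  have hGc : Continuous G := by
    rw [(hopen.isQuotientMap T.continuous hsurj).continuous_iff]
    have : G ∘ T = P ∘ Φ := funext hG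
    rw [this]
    exact P.continuous_of_finiteDimensional.comp hΦ
  let Gi : I → StrongDual 𝕜 F := fun i => (ContinuousLinearMap.proj i).comp ⟨G, hGc⟩
  have hev : ∀ᶠ y : WeakSpace 𝕜 F in 𝓝 0, ∀ i : I, Gi i y ∈ S i := by
    rw [Filter.eventually_all]
    intro i
    have hc : Continuous fun y : WeakSpace 𝕜 F => Gi i y :=
      WeakBilin.eval_continuous (topDualPairing 𝕜 F).flip (Gi i)
    refine hc.continuousAt.eventually_mem ?_
    have h0 : Gi i (0 : WeakSpace 𝕜 F) = 0 := map_zero (Gi i)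
    rw [h0]
    exact hS i
  filter_upwards [hev] with y hy
  -- A preimage `x` of `y` is corrected by an element `k` of the kernel to lie in the neighbourhood.
  obtain ⟨x, rfl⟩ := hsurj y
  obtain ⟨k, hk, hkx⟩ := hπ' x
  have hTk : T k = 0 := hk
  have hmem : x - k ∈ (WeakSpace.map T : E → F) ⁻¹' U := by
    refine hWU (hSW fun i hi => ?_)
    have h1 := hy ⟨i, hi⟩
    have h2 : Gi ⟨i, hi⟩ (T x) = i x - i k := by
      change G (T x) ⟨i, hi⟩ = _
      rw [hG]
      change Φ x ⟨i, hi⟩ - ((π (Φ x) : (LinearMap.ker T.toLinearMap).map Φ) : I → 𝕜) ⟨i, hi⟩ = _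
      rw [← hkx]
      rfl
    change i (x - k) ∈ S i
    rw [map_sub, ← h2]
    exact h1
  have h3 : T (x - k) ∈ U := hmem
  rwa [map_sub, hTk, sub_zero] at h3

/-- If every bounded subset of `F` lies in the closure of the image of a bounded subset of `E`,
then the strong topology of the dual of `F` is induced by that of the dual of `E`. -/
theorem isInducing_precomp [IsTopologicalAddGroup E] [IsTopologicalAddGroup F]
    [ContinuousSMul 𝕜 E] [ContinuousSMul 𝕜 F] (T : E →L[𝕜] F)
    (hT : ∀ B : Set F, Bornology.IsVonNBounded 𝕜 B →
      ∃ A : Set E, Bornology.IsVonNBounded 𝕜 A ∧ B ⊆ closure (T '' A)) :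
    Topology.IsInducing (ContinuousLinearMap.precomp 𝕜 T : StrongDual 𝕜 F → StrongDual 𝕜 E) := by
  rw [IsTopologicalAddGroup.isInducing_iff_nhds_zero]
  refine le_antisymm ?_ ?_
  · rw [← Filter.map_le_iff_le_comap]
    have h0 :=
      (ContinuousLinearMap.precomp 𝕜 T : StrongDual 𝕜 F →L[𝕜] StrongDual 𝕜 E).continuous.tendsto 0
    rwa [map_zero] at h0
  · refine ContinuousLinearMap.hasBasis_nhds_zero.ge_iff.2 ?_
    rintro ⟨B, V⟩ ⟨hB, hV⟩
    obtain ⟨A, hA, hBA⟩ := hT B hB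
    obtain ⟨V', ⟨hV', hV'c⟩, hVV'⟩ := (closed_nhds_basis (0 : 𝕜)).mem_iff.1 hV
    refine ⟨{f | ∀ x ∈ A, f x ∈ V'}, ContinuousLinearMap.hasBasis_nhds_zero.mem_of_mem
      (i := (A, V')) ⟨hA, hV'⟩, fun a ha y hy => hVV' ?_⟩
    have h1 : closure (T '' A) ⊆ a ⁻¹' V' := by
      refine closure_minimal ?_ (hV'c.preimage a.continuous)
      rintro _ ⟨x, hx, rfl⟩
      exact ha x hx
    exact h1 (hBA hy)

end ContinuousLinearMap

end Operators

/-! ### Lifting totally bounded sets -/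

section Lifting

open scoped Pointwise

variable {𝕜 : Type*} [RCLike 𝕜] {E F : Type*} [AddCommGroup E] [Module 𝕜 E] [TopologicalSpace E]
  [IsTopologicalAddGroup E] [PolynormableSpace 𝕜 E] [FirstCountableTopology E]
  [AddCommGroup F] [Module 𝕜 F] [UniformSpace F] [IsUniformAddGroup F]

/-- A totally bounded set is contained in the closure of the image of a bounded set under any
open surjection from a metrizable locally convex space: it is approximated by the images of
finite sets, each obtained from the previous one by a correction which is small of order `2⁻ⁿ`. -/
theorem ContinuousLinearMap.exists_isVonNBounded_subset_closure_image (T : E →L[𝕜] F)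
    (hsurj : Function.Surjective T) (hopen : IsOpenMap T) {B : Set F} (hB : TotallyBounded B) :
    ∃ A : Set E, Bornology.IsVonNBounded 𝕜 A ∧ B ⊆ closure (T '' A) := by
  obtain ⟨p, hpm, hpc, hp⟩ := PolynormableSpace.exists_seq_seminorm 𝕜 E
  -- The radii are summable, so that infinitely many corrections stay bounded.
  let U : ℕ → Set E := fun n => (p n).ball 0 ((1 / 2) ^ n)
  have hV : ∀ n, T '' U n ∈ 𝓝 (0 : F) := fun n => by
    have h1 := hopen.image_mem_nhds (Seminorm.ball_mem_nhds (hpc n)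
      (by positivity : (0 : ℝ) < (1 / 2) ^ n))
    rwa [map_zero] at h1
  have hcov : ∀ n, ∀ S : Set F, TotallyBounded S → ∃ t ⊆ S, t.Finite ∧
      ∀ w ∈ S, ∃ y ∈ t, w - y ∈ T '' U n := by
    intro n S hS
    have h1 : {q : F × F | q.1 - q.2 ∈ T '' U n} ∈ uniformity F := by
      rw [uniformity_eq_comap_nhds_zero_swapped]
      exact ⟨_, hV n, fun q hq => hq⟩
    obtain ⟨t, htS, htf, ht⟩ := totallyBounded_iff_subset.1 hS _ h1
    refine ⟨t, htS, htf, fun w hw => ?_⟩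
    simpa using ht hw
  let Q : ℕ → Set E → Prop := fun n C => C.Finite ∧ ∀ b ∈ B, ∃ c ∈ C, b - T c ∈ T '' U n
  obtain ⟨C₀, hC₀⟩ : ∃ C, Q 0 C := by
    obtain ⟨t, -, htf, ht⟩ := hcov 0 B hB
    refine ⟨Function.surjInv hsurj '' t, htf.image _, fun b hb => ?_⟩
    obtain ⟨y, hy, hby⟩ := ht b hb
    exact ⟨_, ⟨y, hy, rfl⟩, by rwa [Function.surjInv_eq hsurj]⟩
  have hstep : ∀ n, ∀ C : {C // Q n C}, ∃ C' : {C // Q (n + 1) C},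
      ∀ c' ∈ C'.1, ∃ c ∈ C.1, p n (c' - c) < (1 / 2) ^ n := by
    rintro n ⟨C, hCf, hC⟩
    have hS : TotallyBounded ((B - T '' C) ∩ T '' U n) := by
      refine TotallyBounded.subset Set.inter_subset_left ?_
      rw [← Set.iUnion_sub_right_image]
      refine (totallyBounded_biUnion (hCf.image T)).2 fun y _ => ?_
      exact hB.image (uniformContinuous_id.sub uniformContinuous_const)
    obtain ⟨t, htS, htf, ht⟩ := hcov (n + 1) _ hS
    have hg : ∀ y ∈ t, ∃ x ∈ U n, T x = y := fun y hy => (htS hy).2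
    choose! g hgU hgT using hg
    refine ⟨⟨C + g '' t, hCf.add (htf.image g), fun b hb => ?_⟩, ?_⟩
    · obtain ⟨c, hc, hbc⟩ := hC b hb
      obtain ⟨y, hy, hyb⟩ := ht (b - T c) ⟨Set.sub_mem_sub hb ⟨c, hc, rfl⟩, hbc⟩
      refine ⟨c + g y, Set.add_mem_add hc ⟨y, hy, rfl⟩, ?_⟩
      rwa [map_add, hgT y hy, ← sub_sub]
    · rintro _ ⟨c, hc, _, ⟨y, hy, rfl⟩, rfl⟩
      refine ⟨c, hc, ?_⟩
      have h1 := hgU y hy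
      rw [Seminorm.mem_ball_zero] at h1
      simpa using h1
  -- `C n` is a finite set whose image approximates `B` up to `T (U n)`.
  choose next hnext using hstep
  let C : ∀ n, {C // Q n C} := fun n => Nat.rec ⟨C₀, hC₀⟩ (fun n C => next n C) n
  have hC : ∀ n, ∀ c' ∈ (C (n + 1)).1, ∃ c ∈ (C n).1, p n (c' - c) < (1 / 2) ^ n :=
    fun n => hnext n (C n)
  refine ⟨⋃ n, (C n).1, ?_, fun b hb => ?_⟩
  · refine (PolynormableSpace.withSeminorms 𝕜 E).isVonNBounded_iff_seminorm_bounded.2 ?_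
    rintro ⟨q, hq⟩
    have hq1 : {x | q x < 1} ∈ 𝓝 (0 : E) :=
      (isOpen_Iio.preimage hq).mem_nhds (by simp)
    -- Only the corrections from the `k`-th on are controlled by `p k`; before, finiteness is used.
    obtain ⟨k, hk⟩ := hp _ hq1
    have hqk : q ≤ p k := Seminorm.le_of_forall_lt_one fun x hx =>
      (hk ((p k).mem_ball_zero.2 hx)).le
    have hfin : (⋃ n ∈ Set.Iic k, (C n).1).Finite :=
      (Set.finite_Iic k).biUnion fun n _ => (C n).2.1
    obtain ⟨M, hM⟩ := (hfin.image (p k)).bddAbove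
    have hM' : ∀ n ≤ k, ∀ c ∈ (C n).1, p k c ≤ M := fun n hn c hc =>
      hM ⟨c, Set.mem_biUnion (show n ∈ Set.Iic k from hn) hc, rfl⟩
    have hbd : ∀ j, ∀ c ∈ (C (k + j)).1, p k c ≤ M + 2 - 2 * (1 / 2) ^ j := by
      intro j
      induction j with
      | zero => intro c hc; have := hM' k le_rfl c hc; simpa using this
      | succ j ih =>
        intro c' hc'
        obtain ⟨c, hc, hcc⟩ := hC (k + j) c' hc'
        have h1 : p k (c' - c) ≤ p (k + j) (c' - c) := hpm (Nat.le_add_right k j) _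
        have h2 : p k c' ≤ p k c + p k (c' - c) := by
          simpa using map_add_le_add (p k) c (c' - c)
        have h3 : ((1 : ℝ) / 2) ^ (k + j) ≤ (1 / 2) ^ j :=
          pow_le_pow_of_le_one (by norm_num) (by norm_num) (Nat.le_add_left j k)
        have h4 := ih c hc
        rw [pow_succ]
        linarith
    refine ⟨max (M + 2) 0 + 1, by positivity, fun x hx => ?_⟩
    obtain ⟨n, hn⟩ := Set.mem_iUnion.1 hx
    have hx2 : p k x ≤ M + 2 := by
      rcases le_total n k with h | h
      · linarith [hM' n h x hn]
      · obtain ⟨j, rfl⟩ := Nat.exists_eq_add_of_le h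
        have : (0 : ℝ) ≤ 2 * (1 / 2) ^ j := by positivity
        linarith [hbd j x hn]
    exact ((hqk x).trans (hx2.trans (le_max_left _ _))).trans_lt (lt_add_one _)
  · have h1 : ∀ n, ∃ c ∈ (C n).1, ∃ x ∈ U n, T x = b - T c := fun n => (C n).2.2 b hb
    choose c hc x hx hxc using h1
    have hx0 : Filter.Tendsto x Filter.atTop (𝓝 0) := by
      intro W hW
      obtain ⟨N, hN⟩ := hp W hW
      rw [Filter.mem_map]
      filter_upwards [Filter.eventually_ge_atTop N] with n hn
      refine hN ((p N).mem_ball_zero.2 ((hpm hn _).trans_lt ?_))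
      exact ((p n).mem_ball_zero.1 (hx n)).trans_le (pow_le_one₀ (by norm_num) (by norm_num))
    have hlim : Filter.Tendsto (fun n => T (c n)) Filter.atTop (𝓝 b) := by
      have h2 := tendsto_const_nhds (x := b).sub ((T.continuous.tendsto 0).comp hx0)
      simpa [Function.comp_def, hxc] using h2
    exact mem_closure_of_tendsto hlim (Filter.Eventually.of_forall fun n =>
      ⟨c n, Set.mem_iUnion.2 ⟨n, hc n⟩, rfl⟩)

end Lifting

/-! ### Bounded sets of Schwartz functions -/

section Montel

instance SchwartzMap.polynormableSpace {𝕜 E F : Type*} [RCLike 𝕜] [NormedAddCommGroup E]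
    [NormedSpace ℝ E] [NormedAddCommGroup F] [NormedSpace ℝ F] [NormedSpace 𝕜 F]
    [SMulCommClass ℝ 𝕜 F] : PolynormableSpace 𝕜 𝓢(E, F) :=
  (schwartz_withSeminorms 𝕜 E F).toPolynormableSpace

instance ContinuousMultilinearMap.finiteDimensional {ι E F : Type*} [Finite ι]
    [NormedAddCommGroup E] [NormedSpace ℝ E] [FiniteDimensional ℝ E]
    [NormedAddCommGroup F] [NormedSpace ℝ F] [FiniteDimensional ℝ F] :
    FiniteDimensional ℝ (ContinuousMultilinearMap ℝ (fun _ : ι => E) F) :=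
  Module.Finite.of_injective
    (ContinuousMultilinearMap.toMultilinearMapLinear :
      ContinuousMultilinearMap ℝ (fun _ : ι => E) F →ₗ[ℝ] MultilinearMap ℝ (fun _ : ι => E) F)
    ContinuousMultilinearMap.toMultilinearMap_injective

variable {E F : Type*} [NormedAddCommGroup E] [NormedSpace ℝ E] [FiniteDimensional ℝ E]
  [NormedAddCommGroup F] [NormedSpace ℝ F]

/-- For a family of Schwartz functions bounded in the seminorms, smallness of one seminorm follows
from smallness of a derivative on a suitable finite set of points: decay deals with the points far
from the origin, and the bound on the next derivative with those between the chosen points. -/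
theorem SchwartzMap.exists_finite_seminorm_le (k l : ℕ) (M N : ℝ) {ε : ℝ} (hε : 0 < ε) :
    ∃ t : Set E, t.Finite ∧ ∃ δ > 0, ∀ g : 𝓢(E, F), SchwartzMap.seminorm ℝ (k + 1) l g ≤ M →
      SchwartzMap.seminorm ℝ 0 (l + 1) g ≤ N →
      (∀ x ∈ t, ‖iteratedFDeriv ℝ l g x‖ ≤ δ) → SchwartzMap.seminorm ℝ k l g ≤ ε := by
  -- Outside the ball of radius `R`, the weight `‖x‖ ^ (k + 1)` gains a factor `R ≥ M / ε`.
  set R : ℝ := max (M / ε) 1 with hR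
  have hR1 : 1 ≤ R := le_max_right _ _
  have hR0 : 0 < R := by linarith
  have hMR : M ≤ ε * R := by
    have := le_max_left (M / ε) 1
    rwa [← hR, div_le_iff₀ hε, mul_comm] at this
  have hRk : 0 < R ^ k := by positivity
  set δ : ℝ := ε / (2 * R ^ k) with hδ
  have hδ0 : 0 < δ := by positivity
  have hN1 : 0 < max N 0 + 1 := by positivity
  set η : ℝ := δ / (max N 0 + 1) with hη
  have hη0 : 0 < η := by positivity
  obtain ⟨t, -, htf, ht⟩ := totallyBounded_iff_subset.1
    (isCompact_closedBall (0 : E) R).totallyBounded _ (Metric.dist_mem_uniformity hη0)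
  refine ⟨t, htf, δ, hδ0, fun g hM hN hg => ?_⟩
  refine SchwartzMap.seminorm_le_bound ℝ k l g hε.le fun x => ?_
  rcases le_total ‖x‖ R with hx | hx
  · obtain ⟨y, hy, hxy⟩ : ∃ y ∈ t, dist x y < η := by
      simpa using ht (mem_closedBall_zero_iff.2 hx)
    have hlip : ‖iteratedFDeriv ℝ l g x - iteratedFDeriv ℝ l g y‖ ≤ (max N 0 + 1) * ‖x - y‖ := by
      refine Convex.norm_image_sub_le_of_norm_fderiv_le (𝕜 := ℝ) (s := Set.univ) (fun z _ => ?_)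
        (fun z _ => ?_) convex_univ trivial trivial
      · exact ((g.smooth (l + 1)).differentiable_iteratedFDeriv
          (by exact_mod_cast Nat.lt_succ_self l)) z
      · rw [norm_fderiv_iteratedFDeriv]
        have h1 := g.norm_iteratedFDeriv_le_seminorm ℝ (l + 1) z
        linarith [le_max_left N 0]
    have h2 : (max N 0 + 1) * ‖x - y‖ ≤ δ := by
      rw [dist_eq_norm] at hxy
      calc (max N 0 + 1) * ‖x - y‖ ≤ (max N 0 + 1) * η := by gcongr
        _ = δ := by rw [hη]; field_simp
    have h3 : ‖iteratedFDeriv ℝ l g x‖ ≤ 2 * δ := by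
      have h4 := norm_le_norm_add_norm_sub' (iteratedFDeriv ℝ l g x) (iteratedFDeriv ℝ l g y)
      linarith [hg y hy]
    calc ‖x‖ ^ k * ‖iteratedFDeriv ℝ l g x‖ ≤ R ^ k * (2 * δ) := by gcongr
      _ = ε := by rw [hδ]; field_simp
  · have h1 := g.le_seminorm ℝ (k + 1) l x
    have h2 : R * (‖x‖ ^ k * ‖iteratedFDeriv ℝ l g x‖) ≤ R * ε := by
      calc R * (‖x‖ ^ k * ‖iteratedFDeriv ℝ l g x‖)
          ≤ ‖x‖ * (‖x‖ ^ k * ‖iteratedFDeriv ℝ l g x‖) := by gcongr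
        _ = ‖x‖ ^ (k + 1) * ‖iteratedFDeriv ℝ l g x‖ := by ring
        _ ≤ R * ε := by linarith
    exact le_of_mul_le_mul_left h2 hR0

/-- Bounded sets in the Schwartz space are totally bounded: an ultrafilter on such a set is Cauchy,
because by finite dimensionality its images under the evaluations of derivatives are. -/
theorem SchwartzMap.totallyBounded_of_isVonNBounded [FiniteDimensional ℝ F] {B : Set 𝓢(E, F)}
    (hB : Bornology.IsVonNBounded ℝ B) : TotallyBounded B := by
  have hBs := (schwartz_withSeminorms ℝ E F).isVonNBounded_iff_seminorm_bounded.1 hB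
  rw [totallyBounded_iff_ultrafilter]
  intro 𝒰 h𝒰
  have hpt : ∀ (l : ℕ) (x : E) (δ : ℝ), 0 < δ → ∃ A ∈ 𝒰, ∀ φ ∈ A, ∀ ψ ∈ A,
      ‖iteratedFDeriv ℝ l φ x - iteratedFDeriv ℝ l ψ x‖ < δ := by
    intro l x δ hδ
    obtain ⟨r, -, hr⟩ := hBs (0, l)
    let e : 𝓢(E, F) → E [×l]→L[ℝ] F := fun φ => iteratedFDeriv ℝ l φ x
    have : ProperSpace (E [×l]→L[ℝ] F) := FiniteDimensional.proper ℝ _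
    have htb : TotallyBounded (e '' B) := by
      refine TotallyBounded.subset ?_ (isCompact_closedBall (0 : E [×l]→L[ℝ] F) r).totallyBounded
      rintro _ ⟨φ, hφ, rfl⟩
      exact mem_closedBall_zero_iff.2
        ((φ.norm_iteratedFDeriv_le_seminorm ℝ l x).trans (hr φ hφ).le)
    have hc : Cauchy ((𝒰.map e : Ultrafilter _) : Filter (E [×l]→L[ℝ] F)) := by
      refine totallyBounded_iff_ultrafilter.1 htb _ ?_
      rw [Filter.le_principal_iff] at h𝒰 ⊢
      exact Filter.mem_map.2 (Filter.mem_of_superset h𝒰 (Set.subset_preimage_image e B))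
    obtain ⟨A, hA, hA'⟩ := (Metric.cauchy_iff.1 hc).2 δ hδ
    refine ⟨e ⁻¹' A, hA, fun φ hφ ψ hψ => ?_⟩
    rw [← dist_eq_norm]
    exact hA' _ hφ _ hψ
  have hsemi : ∀ (k l : ℕ) (ε : ℝ), 0 < ε → ∃ A ∈ 𝒰, ∀ φ ∈ A, ∀ ψ ∈ A,
      SchwartzMap.seminorm ℝ k l (φ - ψ) ≤ ε := by
    intro k l ε hε
    obtain ⟨M, -, hM⟩ := hBs (k + 1, l)
    obtain ⟨N, -, hN⟩ := hBs (0, l + 1)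
    obtain ⟨t, ht, δ, hδ, h⟩ :=
      SchwartzMap.exists_finite_seminorm_le (E := E) (F := F) k l (M + M) (N + N) hε
    choose A hA hA' using fun x : E => hpt l x δ hδ
    refine ⟨B ∩ ⋂ x ∈ t, A x, Filter.inter_mem (Filter.le_principal_iff.1 h𝒰)
      ((Filter.biInter_mem ht).2 fun x _ => hA x), fun φ hφ ψ hψ => h _ ?_ ?_ fun x hx => ?_⟩
    · refine (map_sub_le_add _ _ _).trans (add_le_add (hM φ hφ.1).le (hM ψ hψ.1).le)
    · refine (map_sub_le_add _ _ _).trans (add_le_add (hN φ hφ.1).le (hN ψ hψ.1).le)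
    · have h1 : iteratedFDeriv ℝ l (φ - ψ : 𝓢(E, F)) x =
          iteratedFDeriv ℝ l φ x - iteratedFDeriv ℝ l ψ x := by
        have := iteratedFDeriv_sub_apply (𝕜 := ℝ) (x := x) ((φ.smooth l).contDiffAt)
          ((ψ.smooth l).contDiffAt)
        exact this
      rw [h1]
      exact (hA' x φ (Set.mem_iInter₂.1 hφ.2 x hx) ψ (Set.mem_iInter₂.1 hψ.2 x hx)).le
  have hbasis := (schwartz_withSeminorms ℝ E F).hasBasis_zero_ball.uniformity_of_nhds_zero
  refine hbasis.cauchy_iff.2 ⟨𝒰.neBot, ?_⟩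
  rintro ⟨s, r⟩ hr
  choose A hA hA' using fun i : ℕ × ℕ => hsemi i.1 i.2 (r / 2) (half_pos hr)
  refine ⟨⋂ i ∈ s, A i, (Filter.biInter_finset_mem s).2 fun i _ => hA i, fun φ hφ ψ hψ => ?_⟩
  change ψ - φ ∈ (s.sup (schwartzSeminormFamily ℝ E F)).ball 0 r
  rw [Seminorm.mem_ball_zero]
  refine Seminorm.finset_sup_apply_lt hr fun i hi => ?_
  exact (hA' i ψ (Set.mem_iInter₂.1 hψ i hi) φ (Set.mem_iInter₂.1 hφ i hi)).trans_lt
    (half_lt_self hr)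

end Montel

/-! ### Superpositions -/

namespace SFamily

variable {𝕜 : Type*} [RCLike 𝕜] {m n : ℕ}

theorem range_weakTranspose_hat (v : SFamily 𝕜 m n) :
    Set.range v.hat.weakTranspose =
      StrongDual.toWeakDual '' (v.sSpan : Set (TemperedDual 𝕜 n)) := by
  ext f
  constructor
  · rintro ⟨a, rfl⟩
    exact ⟨v.superposition a, ⟨a, rfl⟩, rfl⟩
  · rintro ⟨_, ⟨a, rfl⟩, rfl⟩
    exact ⟨a, rfl⟩

theorem sLinearIndependent_iff_injective (v : SFamily 𝕜 m n) :
    v.SLinearIndependent ↔ Function.Injective v.superposition :=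
  (injective_iff_map_eq_zero v.superposition).symm

theorem injective_superposition_of_surjective (v : SFamily 𝕜 m n)
    (h : Function.Surjective v.hat) : Function.Injective v.superposition := by
  intro a b hab
  ext y
  obtain ⟨x, rfl⟩ := h y
  exact DFunLike.congr_fun hab x

/-- For a topologically exhaustive and `𝓢`-linearly independent family `v`, the operator `v̂` is
open. -/
theorem isOpenMap_hat (v : SFamily 𝕜 m n) (hv : v.TopologicallyExhaustive)
    (hinj : v.SLinearIndependent) : IsOpenMap v.hat := by
  have hcl : IsClosed (Set.range v.hat.weakTranspose) := by
    rw [range_weakTranspose_hat]; exact hv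
  exact v.hat.toLinearMap.toAddMonoidHom.isOpenMap_of_closure_image_mem_nhds v.hat.continuous
    fun U hU => v.hat.closure_image_mem_nhds_of_isClosed_range
      (v.sLinearIndependent_iff_injective.1 hinj) hcl hU

/-- An open linear map is onto: its range is a subspace with interior. -/
theorem surjective_hat_of_isOpenMap (v : SFamily 𝕜 m n) (h : IsOpenMap v.hat) :
    Function.Surjective v.hat :=
  LinearMap.range_eq_top.1 <| Submodule.eq_top_of_nonempty_interior'
    (LinearMap.range v.hat.toLinearMap) <| by
      rw [LinearMap.coe_range]
      exact ⟨0, mem_interior_iff_mem_nhds.2 (h.isOpen_range.mem_nhds ⟨0, map_zero _⟩)⟩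

/-- Every evaluation at a point of `𝓢ₘ` is, through `v̂`, an evaluation at a point of `𝓢ₙ`. -/
theorem isInducing_superpositionWeak (v : SFamily 𝕜 m n) (h : Function.Surjective v.hat) :
    Topology.IsInducing v.superpositionWeak := by
  have hm : Topology.IsInducing fun (f : WeakDual 𝕜 (TestSpace 𝕜 m)) y => f y := ⟨rfl⟩
  have hn : Topology.IsInducing fun (f : WeakDual 𝕜 (TestSpace 𝕜 n)) x => f x := ⟨rfl⟩
  exact hn.of_comp_iff.1 ((h.isEmbedding_comp (X := 𝕜) v.hat).isInducing.comp hm)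

theorem isInducing_superposition (v : SFamily 𝕜 m n) (hs : Function.Surjective v.hat)
    (ho : IsOpenMap v.hat) : Topology.IsInducing v.superposition :=
  v.hat.isInducing_precomp fun _ hB =>
    v.hat.exists_isVonNBounded_subset_closure_image hs ho
      (SchwartzMap.totallyBounded_of_isVonNBounded (hB.restrict_scalars ℝ))

end SFamily

theorem mainTheorem4 {𝕜 : Type*} [RCLike 𝕜] {m n : ℕ} (v : SFamily 𝕜 m n)
    (hv : v.TopologicallyExhaustive) :
    List.TFAE [
      v.SLinearIndependent,
      Function.Injective v.superpositionWeak ∧ IsTopologicalHom v.superpositionWeak,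
      Function.Injective v.superposition ∧ IsTopologicalHom v.superposition,
      Function.Surjective v.hatWeak ∧ IsTopologicalHom v.hatWeak,
      Function.Surjective v.hat ∧ IsTopologicalHom v.hat.toLinearMap] := by
  have hopen : v.SLinearIndependent → IsOpenMap v.hat := v.isOpenMap_hat hv
  have hsurj : v.SLinearIndependent → Function.Surjective v.hat := fun h =>
    v.surjective_hat_of_isOpenMap (hopen h)
  tfae_have 1 → 2 := fun h =>
    have hi : Function.Injective v.superpositionWeak := v.sLinearIndependent_iff_injective.1 h
    ⟨hi, Topology.IsEmbedding.isStrictMap ⟨v.isInducing_superpositionWeak (hsurj h), hi⟩⟩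
  tfae_have 2 → 1 := fun h => v.sLinearIndependent_iff_injective.2 h.1
  tfae_have 1 → 3 := fun h =>
    have hi := v.sLinearIndependent_iff_injective.1 h
    ⟨hi, Topology.IsEmbedding.isStrictMap ⟨v.isInducing_superposition (hsurj h) (hopen h), hi⟩⟩
  tfae_have 3 → 1 := fun h => v.sLinearIndependent_iff_injective.2 h.1
  tfae_have 1 → 4 := fun h =>
    ⟨hsurj h, IsOpenMap.isStrictMap (v.hat.isOpenMap_weakSpaceMap (hsurj h) (hopen h))
      (WeakSpace.map v.hat).continuous⟩
  tfae_have 4 → 1 := fun h =>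
    v.sLinearIndependent_iff_injective.2 (v.injective_superposition_of_surjective h.1)
  tfae_have 1 → 5 := fun h => ⟨hsurj h, (hopen h).isStrictMap v.hat.continuous⟩
  tfae_have 5 → 1 := fun h =>
    v.sLinearIndependent_iff_injective.2 (v.injective_superposition_of_surjective h.1)
  tfae_finish
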